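/- Let $\mathbb K$ be a field of characteristic zero. A Lie-Yamaguti algebra is a vector space $L$ with a bilinear bracket $[-,-]$ and a trilinear bracket $\{-,-,-\}$ such that, for all $x,y,z,a,b\in L$ (with $\circlearrowleft_{x,y,z}$ the sum over cyclic permutations), $[x,y]=-[y,x]$; $\{x,y,z\}=-\{y,x,z\}$; $\circlearrowleft_{x,y,z}[[x,y],z]+\circlearrowleft_{x,y,z}\{x,y,z\}=0$; $\circlearrowleft_{x,y,z}\{[x,y],z,a\}=0$; $\{a,b,[x,y]\}=[\{a,b,x\},y]+[x,\{a,b,y\}]$; $\{a,b,\{x,y,z\}\}=\{\{a,b,x\},y,z\}+\{x,\{a,b,y\},z\}+\{x,y,\{a,b,z\}\}$. A representation $(V;\rho,\theta)$ of $L$ is a vector space $V$ with a linear map $\rho:L\to\mathfrak{gl}(V)$ and a bilinear map $\theta:L\times L\to\mathfrak{gl}(V)$ such that, with $D(x,y)=\theta(y,x)-\theta(x,y)-\rho([x,y])+\rho(x)\rho(y)-\rho(y)\rho(x)$, one has $\theta([x,y],a)=\theta(x,a)\rho(y)-\theta(y,a)\rho(x)$; $D(a,b)\rho(x)=\rho(x)D(a,b)+\rho(\{a,b,x\})$;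 $\theta(x,[a,b])=\rho(a)\theta(x,b)-\rho(b)\theta(x,a)$; $D(a,b)\theta(x,y)=\theta(x,y)D(a,b)+\theta(\{a,b,x\},y)+\theta(x,\{a,b,y\})$; $\theta(a,\{x,y,z\})=\theta(y,z)\theta(a,x)-\theta(x,z)\theta(a,y)+D(x,y)\theta(a,z)$. Let $\lambda\in\mathbb K$, and let $T:L\to L$ be a Reynolds operator of weight $\lambda$, i.e. a linear map with $[Tx,Ty]=T([Tx,y]+[x,Ty]+\lambda[Tx,Ty])$ and $\{Tx,Ty,Tz\}=T(\{x,Ty,Tz\}+\{Tx,y,Tz\}+\{Tx,Ty,z\}+2\lambda\{Tx,Ty,Tz\})$. Let $(V;\rho,\theta)$ be a representation of $L$ and $T_V:V\to V$ a linear map with $\rho(Tx)T_Vu=T_V(\rho(Tx)u+\rho(x)T_Vu+\lambda\rho(Tx)T_Vu)$ and $\theta(Tx,Ty)T_Vu=T_V(\theta(Tx,Ty)u+\theta(Tx,y)T_Vu+\theta(x,Ty)T_Vu+2\lambda\theta(Tx,Ty)T_Vu)$. The descendent Lie-Yamaguti algebra $L_T$ is the vector space $L$ with $[x,y]_T=[Tx,y]+[x,Ty]+\lambda[Tx,Ty]$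 and $\{x,y,z\}_T=\{x,Ty,Tz\}+\{Tx,y,Tz\}+\{Tx,Ty,z\}+2\lambda\{Tx,Ty,Tz\}$, and $V$ is a representation $(V;\rho_T,\theta_T)$ of $L_T$ through $\rho_T(x)u=\rho(Tx)u-T_V(\lambda\rho(Tx)u+\rho(x)u)$ and $\theta_T(x,y)u=\theta(Tx,Ty)u-T_V(2\lambda\theta(Tx,Ty)u+\theta(Tx,y)u+\theta(x,Ty)u)$. For a Lie-Yamaguti algebra $L$ and a representation $V$, put $\mathcal C^1_{\mathrm{LY}}(L,V)=\mathrm{Hom}(L,V)$ and, for $n\ge1$, $\mathcal C^{n+1}_{\mathrm{LY}}(L,V)=\mathrm{Hom}((\wedge^2L)^{\otimes n},V)\times\mathrm{Hom}((\wedge^2L)^{\otimes n}\otimes L,V)$. The Yamaguti coboundary $\delta^{n+1}=(\delta^{n+1}_I,\delta^{n+1}_{II}):\mathcal C^{n+1}_{\mathrm{LY}}(L,V)\to\mathcal C^{n+2}_{\mathrm{LY}}(L,V)$ is given by $\delta^1_I(f)(x,y)=\rho(x)f(y)-\rho(y)f(x)-f([x,y])$, $\delta^1_{II}(f)(x,y,z)=D(x,y)f(z)+\theta(y,z)f(x)-\theta(x,z)f(y)-f(\{x,y,z\})$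 and, for $n\ge1$, $X_i=x_i\wedge y_i$, writing $D(X_k)=D(x_k,y_k)$ and $X_k\cdot X_l=\{x_k,y_k,x_l\}\wedge y_l+x_l\wedge\{x_k,y_k,y_l\}$, $$\begin{aligned}\delta_I^{n+1}(f,g)(X_1,\dots,X_{n+1})={}&(-1)^n\big(\rho(x_{n+1})g(X_1,\dots,X_n,y_{n+1})-\rho(y_{n+1})g(X_1,\dots,X_n,x_{n+1})-g(X_1,\dots,X_n,[x_{n+1},y_{n+1}])\big)\\&+\sum_{k=1}^n(-1)^{k+1}D(X_k)f(X_1,\dots,\widehat{X_k},\dots,X_{n+1})\\&+\sum_{1\le k<l\le n+1}(-1)^kf(X_1,\dots,\widehat{X_k},\dots,X_k\cdot X_l,\dots,X_{n+1}),\\ \delta_{II}^{n+1}(f,g)(X_1,\dots,X_{n+1},z)={}&(-1)^n\big(\theta(y_{n+1},z)g(X_1,\dots,X_n,x_{n+1})-\theta(x_{n+1},z)g(X_1,\dots,X_n,y_{n+1})\big)\\&+\sum_{k=1}^{n+1}(-1)^{k+1}D(X_k)g(X_1,\dots,\widehat{X_k},\dots,X_{n+1},z)\\&+\sum_{1\le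 k<l\le n+1}(-1)^kg(X_1,\dots,\widehat{X_k},\dots,X_k\cdot X_l,\dots,X_{n+1},z)\\&+\sum_{k=1}^{n+1}(-1)^kg(X_1,\dots,\widehat{X_k},\dots,X_{n+1},\{x_k,y_k,z\}),\end{aligned}$$ where $X_k\cdot X_l$ stands in the place of $X_l$. Let $(\mathcal C^\bullet_{\mathrm{RO}}(L,V),\partial^\bullet)$ be the cochain spaces and coboundary maps of $L_T$ with coefficients in $(V;\rho_T,\theta_T)$. Define linear maps $\Phi^{n+1}:\mathcal C^{n+1}_{\mathrm{LY}}(L,V)\to\mathcal C^{n+1}_{\mathrm{RO}}(L,V)$ by $\Phi^1(f)=f\circ T-T_V\circ f$ and, for $n\ge1$, $\Phi^{n+1}(f,g)=(\Phi^{n+1}_I(f),\Phi^{n+1}_{II}(g))$, where, regarding $f$ and $g$ as functions of $2n$ and $2n+1$ arguments in $L$, $$\Phi_I^{n+1}(f)=f\circ(T,\dots,T)-T_V\Big(\sum_{i=1}^{2n}f\circ(\underbrace{T,\dots,T}_{i-1},\mathrm{Id},\underbrace{T,\dots,T}_{2n-i})+(2n-1)\lambda\,f\circ(T,\dots,T)\Big),$$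 $$\Phi_{II}^{n+1}(g)=g\circ(T,\dots,T)-T_V\Big(\sum_{i=1}^{2n+1}g\circ(\underbrace{T,\dots,T}_{i-1},\mathrm{Id},\underbrace{T,\dots,T}_{2n+1-i})+2n\lambda\,g\circ(T,\dots,T)\Big).$$ Then $\Phi$ is a cochain map: $\Phi^{n+2}\circ\delta^{n+1}=\partial^{n+1}\circ\Phi^{n+1}$ for all $n\ge0$. -/

import Mathlib

namespace LieYam

section Wedge

variable {K L M : Type*} [Field K] [AddCommGroup L] [Module K L] [AddCommGroup M] [Module K M]

/-- The decomposable element `x ∧ y` of the exterior square of `L`. -/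
noncomputable def wedge (x y : L) : ⋀[K]^2 L := exteriorPower.ιMulti K 2 ![x, y]

/-- The linear map `⋀² L → M`, `x ∧ y ↦ B x y`, induced by an alternating bilinear map `B`. -/
noncomputable def liftWedge (B : L →ₗ[K] L →ₗ[K] M) (hB : ∀ x, B x x = 0) : ⋀[K]^2 L →ₗ[K] M :=
  exteriorPower.alternatingMapLinearEquiv
    { toFun := fun v => B (v 0) (v 1)
      map_update_add' := by
        intro _ v i x y
        fin_cases i <;> simp [Function.update]
      map_update_smul' := by
        intro _ v i c x
        fin_cases i <;> simp [Function.update]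
      map_eq_zero_of_eq' := by
        intro v i j h hij
        fin_cases i <;> fin_cases j <;> simp_all }

@[simp] theorem liftWedge_wedge (B : L →ₗ[K] L →ₗ[K] M) (hB : ∀ x, B x x = 0) (x y : L) :
    liftWedge B hB (wedge x y) = B x y := by
  simp [liftWedge, wedge]

theorem wedge_self (x : L) : (wedge x x : ⋀[K]^2 L) = 0 :=
  (exteriorPower.ιMulti K 2).map_eq_zero_of_eq ![x, x] (i := 0) (j := 1) rfl (by decide)

/-- Two linear maps on `⋀² L` agree as soon as they agree on all `x ∧ y`. -/
theorem wedge_hom_ext {f g : ⋀[K]^2 L →ₗ[K] M} (h : ∀ x y, f (wedge x y) = g (wedge x y)) :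
    f = g := by
  refine exteriorPower.linearMap_ext (AlternatingMap.ext fun v => ?_)
  have hv : v = ![v 0, v 1] := by ext i; fin_cases i <;> rfl
  rw [hv]
  exact h (v 0) (v 1)

/-- `(x, y) ↦ x ∧ y` as a bilinear map. -/
noncomputable def wedgeBilin : L →ₗ[K] L →ₗ[K] ⋀[K]^2 L :=
  LinearMap.mk₂ K wedge
    (fun x x' y => by ext; simp [wedge, add_mul])
    (fun c x y => by ext; simp [wedge])
    (fun x y y' => by ext; simp [wedge, mul_add])
    (fun c x y => by ext; simp [wedge])

@[simp] theorem wedgeBilin_apply (x y : L) : (wedgeBilin x y : ⋀[K]^2 L) = wedge x y := rfl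

theorem wedge_neg_swap (x y : L) : (wedge x y : ⋀[K]^2 L) + wedge y x = 0 := by
  have h := wedge_self (K := K) (x + y)
  simp only [← wedgeBilin_apply, map_add, LinearMap.add_apply] at h
  simp only [wedgeBilin_apply, wedge_self, zero_add, add_zero] at h
  rw [← h, add_comm]

/-- `φ ↦ (x ∧ y ↦ φ x ∧ y + x ∧ φ y)`. -/
noncomputable def wedgeDer : (L →ₗ[K] L) →ₗ[K] (⋀[K]^2 L →ₗ[K] ⋀[K]^2 L) where
  toFun φ := liftWedge (wedgeBilin ∘ₗ φ + wedgeBilin.compl₂ φ)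
    (fun x => by simpa using wedge_neg_swap (φ x) x)
  map_add' φ ψ := wedge_hom_ext fun x y => by
    simp only [liftWedge_wedge, LinearMap.add_apply, LinearMap.comp_apply, LinearMap.compl₂_apply,
      map_add]
    abel
  map_smul' c φ := wedge_hom_ext fun x y => by
    simp [-wedgeBilin_apply]

@[simp] theorem wedgeDer_wedge (φ : L →ₗ[K] L) (x y : L) :
    wedgeDer φ (wedge x y : ⋀[K]^2 L) = wedge (φ x) y + wedge x (φ y) := by
  simp [wedgeDer]

end Wedge

/-- A Lie-Yamaguti algebra structure on the vector space `L`: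
`br x y = [x, y]` and `tr x y z = {x, y, z}`. -/
structure LieYamaguti (K L : Type*) [Field K] [AddCommGroup L] [Module K L] where
  br : L →ₗ[K] L →ₗ[K] L
  tr : L →ₗ[K] L →ₗ[K] L →ₗ[K] L
  ly1 : ∀ x y, br x y = -br y x
  ly2 : ∀ x y z, tr x y z = -tr y x z
  ly3 : ∀ x y z, (br (br x y) z + br (br z x) y + br (br y z) x)
    + (tr x y z + tr z x y + tr y z x) = 0
  ly4 : ∀ x y z a, tr (br x y) z a + tr (br z x) y a + tr (br y z) x a = 0
  ly5 : ∀ a b x y, tr a b (br x y) = br (tr a b x) y + br x (tr a b y)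
  ly6 : ∀ a b x y z, tr a b (tr x y z)
    = tr (tr a b x) y z + tr x (tr a b y) z + tr x y (tr a b z)

section Basic

variable {K L V : Type*} [Field K] [AddCommGroup L] [Module K L] [AddCommGroup V] [Module K V]

/-- `D(x,y) = θ(y,x) - θ(x,y) - ρ([x,y]) + ρ(x)ρ(y) - ρ(y)ρ(x)`, where the product in
`Module.End K V` is composition. -/
noncomputable def LieYamaguti.D (A : LieYamaguti K L) (ρ : L →ₗ[K] Module.End K V)
    (θ : L →ₗ[K] L →ₗ[K] Module.End K V) : L →ₗ[K] L →ₗ[K] Module.End K V :=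
  LinearMap.mk₂ K (fun x y => θ y x - θ x y - ρ (A.br x y) + ρ x * ρ y - ρ y * ρ x)
    (by intro x x' y; simp only [map_add, LinearMap.add_apply, add_mul, mul_add]; abel)
    (by intro c x y; simp only [map_smul, LinearMap.smul_apply, smul_mul_assoc, mul_smul_comm,
          smul_sub, smul_add])
    (by intro x y y'; simp only [map_add, LinearMap.add_apply, add_mul, mul_add]; abel)
    (by intro c x y; simp only [map_smul, LinearMap.smul_apply, smul_mul_assoc, mul_smul_comm,
          smul_sub, smul_add])

theorem LieYamaguti.D_apply (A : LieYamaguti K L) (ρ : L →ₗ[K] Module.End K V)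
    (θ : L →ₗ[K] L →ₗ[K] Module.End K V) (x y : L) (u : V) :
    A.D ρ θ x y u = θ y x u - θ x y u - ρ (A.br x y) u + ρ x (ρ y u) - ρ y (ρ x u) := rfl

end Basic

/-- A representation `(V; ρ, θ)` of the Lie-Yamaguti algebra `A`. -/
structure Rep {K L : Type*} [Field K] [AddCommGroup L] [Module K L] (A : LieYamaguti K L)
    (V : Type*) [AddCommGroup V] [Module K V] where
  rho : L →ₗ[K] Module.End K V
  theta : L →ₗ[K] L →ₗ[K] Module.End K V
  r1 : ∀ x y a, theta (A.br x y) a = theta x a * rho y - theta y a * rho x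
  r2 : ∀ a b x, A.D rho theta a b * rho x = rho x * A.D rho theta a b + rho (A.tr a b x)
  r3 : ∀ x a b, theta x (A.br a b) = rho a * theta x b - rho b * theta x a
  r4 : ∀ a b x y, A.D rho theta a b * theta x y
    = theta x y * A.D rho theta a b + theta (A.tr a b x) y + theta x (A.tr a b y)
  r5 : ∀ a x y z, theta a (A.tr x y z)
    = theta y z * theta a x - theta x z * theta a y + A.D rho theta x y * theta a z

section Reynolds

variable {K L V : Type*} [Field K] [AddCommGroup L] [Module K L] [AddCommGroup V] [Module K V]

/-- `D(x,y)` for a representation. -/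
noncomputable def Rep.D {A : LieYamaguti K L} (R : Rep A V) : L →ₗ[K] L →ₗ[K] Module.End K V :=
  A.D R.rho R.theta

theorem Rep.D_def {A : LieYamaguti K L} (R : Rep A V) : A.D R.rho R.theta = R.D := rfl

/-- `T` is a Reynolds operator of weight `lam` on the Lie-Yamaguti algebra `A`. -/
structure LieYamaguti.IsReynolds (A : LieYamaguti K L) (lam : K) (T : L →ₗ[K] L) : Prop where
  br : ∀ x y, A.br (T x) (T y)
    = T (A.br (T x) y + A.br x (T y) + lam • A.br (T x) (T y))
  tr : ∀ x y z, A.tr (T x) (T y) (T z)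
    = T (A.tr x (T y) (T z) + A.tr (T x) y (T z) + A.tr (T x) (T y) z
        + (2 * lam) • A.tr (T x) (T y) (T z))

/-- `(V; ρ, θ, TV)` is a representation of the Reynolds Lie-Yamaguti algebra `(A, T)` of weight
`lam`, where `R = (V; ρ, θ)` is a representation of `A`. -/
structure Rep.IsReynolds {A : LieYamaguti K L} (R : Rep A V) (lam : K) (T : L →ₗ[K] L)
    (TV : V →ₗ[K] V) : Prop where
  rho : ∀ x u, R.rho (T x) (TV u)
    = TV (R.rho (T x) u + R.rho x (TV u) + lam • R.rho (T x) (TV u))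
  theta : ∀ x y u, R.theta (T x) (T y) (TV u)
    = TV (R.theta (T x) (T y) u + R.theta (T x) y (TV u) + R.theta x (T y) (TV u)
        + (2 * lam) • R.theta (T x) (T y) (TV u))

/-- `[x,y]_T = [Tx,y] + [x,Ty] + lam [Tx,Ty]`. -/
noncomputable def LieYamaguti.brT (A : LieYamaguti K L) (lam : K) (T : L →ₗ[K] L) :
    L →ₗ[K] L →ₗ[K] L :=
  A.br ∘ₗ T + A.br.compl₂ T + lam • A.br.compl₁₂ T T

theorem LieYamaguti.brT_apply (A : LieYamaguti K L) (lam : K) (T : L →ₗ[K] L) (x y : L) :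
    A.brT lam T x y = A.br (T x) y + A.br x (T y) + lam • A.br (T x) (T y) := rfl

/-- `{x,y,z}_T = {x,Ty,Tz} + {Tx,y,Tz} + {Tx,Ty,z} + 2 lam {Tx,Ty,Tz}`. -/
noncomputable def LieYamaguti.trT (A : LieYamaguti K L) (lam : K) (T : L →ₗ[K] L) :
    L →ₗ[K] L →ₗ[K] L →ₗ[K] L :=
  LinearMap.mk₂ K (fun x y => A.tr x (T y) ∘ₗ T + A.tr (T x) y ∘ₗ T + A.tr (T x) (T y)
      + (2 * lam) • (A.tr (T x) (T y) ∘ₗ T))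
    (by intro x x' y; ext z
        simp only [map_add, LinearMap.add_apply, LinearMap.comp_apply, LinearMap.smul_apply]
        module)
    (by intro c x y; ext z
        simp only [map_smul, LinearMap.add_apply, LinearMap.comp_apply, LinearMap.smul_apply]
        module)
    (by intro x y y'; ext z
        simp only [map_add, LinearMap.add_apply, LinearMap.comp_apply, LinearMap.smul_apply]
        module)
    (by intro c x y; ext z
        simp only [map_smul, LinearMap.add_apply, LinearMap.comp_apply, LinearMap.smul_apply]
        module)

theorem LieYamaguti.trT_apply (A : LieYamaguti K L) (lam : K) (T : L →ₗ[K] L) (x y z : L) :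
    A.trT lam T x y z = A.tr x (T y) (T z) + A.tr (T x) y (T z) + A.tr (T x) (T y) z
      + (2 * lam) • A.tr (T x) (T y) (T z) := rfl

theorem LieYamaguti.IsReynolds.map_brT {A : LieYamaguti K L} {lam : K} {T : L →ₗ[K] L}
    (hT : A.IsReynolds lam T) (x y : L) : T (A.brT lam T x y) = A.br (T x) (T y) :=
  (hT.br x y).symm

theorem LieYamaguti.IsReynolds.map_trT {A : LieYamaguti K L} {lam : K} {T : L →ₗ[K] L}
    (hT : A.IsReynolds lam T) (x y z : L) :
    T (A.trT lam T x y z) = A.tr (T x) (T y) (T z) :=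
  (hT.tr x y z).symm

/-- The descendent Lie-Yamaguti algebra `L_T = (L, [-,-]_T, {-,-,-}_T)`. -/
noncomputable def LieYamaguti.descendent (A : LieYamaguti K L) {lam : K} {T : L →ₗ[K] L}
    (hT : A.IsReynolds lam T) : LieYamaguti K L where
  br := A.brT lam T
  tr := A.trT lam T
  ly1 x y := by
    simp only [A.brT_apply]
    linear_combination (norm := module) A.ly1 (T x) y + A.ly1 x (T y) + lam • A.ly1 (T x) (T y)
  ly2 x y z := by
    simp only [A.trT_apply]
    linear_combination (norm := module) A.ly2 x (T y) (T z) + A.ly2 (T x) y (T z) + A.ly2 (T x) (T y) z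
      + (2 * lam) • A.ly2 (T x) (T y) (T z)
  ly3 x y z := by
    simp only [↓A.brT_apply, ↓A.trT_apply, ↓hT.map_brT, ↓hT.map_trT, map_add, map_smul,
      LinearMap.add_apply, LinearMap.smul_apply]
    linear_combination (norm := module) A.ly3 x (T y) (T z) + A.ly3 (T x) y (T z) + A.ly3 (T x) (T y) z
      + (2 * lam) • A.ly3 (T x) (T y) (T z)
  ly4 x y z a := by
    simp only [↓A.brT_apply, ↓A.trT_apply, ↓hT.map_brT, ↓hT.map_trT, map_add, map_smul,
      LinearMap.add_apply, LinearMap.smul_apply]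
    linear_combination (norm := module) A.ly4 x (T y) (T z) (T a) + A.ly4 (T x) y (T z) (T a)
      + A.ly4 (T x) (T y) z (T a) + A.ly4 (T x) (T y) (T z) a
      + (3 * lam) • A.ly4 (T x) (T y) (T z) (T a)
  ly5 a b x y := by
    simp only [↓A.brT_apply, ↓A.trT_apply, ↓hT.map_brT, ↓hT.map_trT, map_add, map_smul,
      LinearMap.add_apply, LinearMap.smul_apply]
    linear_combination (norm := module) A.ly5 a (T b) (T x) (T y) + A.ly5 (T a) b (T x) (T y)
      + A.ly5 (T a) (T b) x (T y) + A.ly5 (T a) (T b) (T x) y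
      + (3 * lam) • A.ly5 (T a) (T b) (T x) (T y)
  ly6 a b x y z := by
    simp only [↓A.trT_apply, ↓hT.map_trT, map_add, map_smul,
      LinearMap.add_apply, LinearMap.smul_apply]
    linear_combination (norm := module) A.ly6 a (T b) (T x) (T y) (T z) + A.ly6 (T a) b (T x) (T y) (T z)
      + A.ly6 (T a) (T b) x (T y) (T z) + A.ly6 (T a) (T b) (T x) y (T z)
      + A.ly6 (T a) (T b) (T x) (T y) z
      + (4 * lam) • A.ly6 (T a) (T b) (T x) (T y) (T z)

/-- `ρ_T(x)u = ρ(Tx)u - TV (lam ρ(Tx)u + ρ(x)u)`. -/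
noncomputable def Rep.rhoT {A : LieYamaguti K L} (R : Rep A V) (lam : K) (T : L →ₗ[K] L)
    (TV : V →ₗ[K] V) : L →ₗ[K] Module.End K V where
  toFun x := R.rho (T x) - TV ∘ₗ (lam • R.rho (T x) + R.rho x)
  map_add' x y := by
    ext u; simp only [map_add, LinearMap.add_apply, LinearMap.sub_apply, LinearMap.comp_apply,
      LinearMap.smul_apply, map_smul]; module
  map_smul' c x := by
    ext u; simp only [map_add, LinearMap.add_apply, LinearMap.sub_apply, LinearMap.comp_apply,
      LinearMap.smul_apply, map_smul, RingHom.id_apply]; module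

theorem Rep.rhoT_apply {A : LieYamaguti K L} (R : Rep A V) (lam : K) (T : L →ₗ[K] L)
    (TV : V →ₗ[K] V) (x : L) (u : V) :
    R.rhoT lam T TV x u = R.rho (T x) u - TV (lam • R.rho (T x) u + R.rho x u) := rfl

/-- `θ_T(x,y)u = θ(Tx,Ty)u - TV (2 lam θ(Tx,Ty)u + θ(Tx,y)u + θ(x,Ty)u)`. -/
noncomputable def Rep.thetaT {A : LieYamaguti K L} (R : Rep A V) (lam : K) (T : L →ₗ[K] L)
    (TV : V →ₗ[K] V) : L →ₗ[K] L →ₗ[K] Module.End K V :=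
  LinearMap.mk₂ K (fun x y => R.theta (T x) (T y)
      - TV ∘ₗ ((2 * lam) • R.theta (T x) (T y) + R.theta (T x) y + R.theta x (T y)))
    (by intro x x' y; ext u
        simp only [map_add, LinearMap.add_apply, LinearMap.sub_apply, LinearMap.comp_apply,
          LinearMap.smul_apply, map_smul]
        module)
    (by intro c x y; ext u
        simp only [map_add, LinearMap.add_apply, LinearMap.sub_apply, LinearMap.comp_apply,
          LinearMap.smul_apply, map_smul]
        module)
    (by intro x y y'; ext u
        simp only [map_add, LinearMap.add_apply, LinearMap.sub_apply, LinearMap.comp_apply,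
          LinearMap.smul_apply, map_smul]
        module)
    (by intro c x y; ext u
        simp only [map_add, LinearMap.add_apply, LinearMap.sub_apply, LinearMap.comp_apply,
          LinearMap.smul_apply, map_smul]
        module)

theorem Rep.thetaT_apply {A : LieYamaguti K L} (R : Rep A V) (lam : K) (T : L →ₗ[K] L)
    (TV : V →ₗ[K] V) (x y : L) (u : V) :
    R.thetaT lam T TV x y u = R.theta (T x) (T y) u
      - TV ((2 * lam) • R.theta (T x) (T y) u + R.theta (T x) y u + R.theta x (T y) u) := rfl

section

variable {A : LieYamaguti K L} {R : Rep A V} {lam : K} {T : L →ₗ[K] L} {TV : V →ₗ[K] V}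

theorem Rep.IsReynolds.rhoT_map (hV : R.IsReynolds lam T TV) (x : L) (u : V) :
    R.rhoT lam T TV x (TV u) = TV (R.rho (T x) u) := by
  have h := hV.rho x u
  simp only [map_add, map_smul] at h
  simp only [R.rhoT_apply, map_add, map_smul]
  linear_combination (norm := module) h

theorem Rep.IsReynolds.thetaT_map (hV : R.IsReynolds lam T TV) (x y : L) (u : V) :
    R.thetaT lam T TV x y (TV u) = TV (R.theta (T x) (T y) u) := by
  have h := hV.theta x y u
  simp only [map_add, map_smul] at h
  simp only [R.thetaT_apply, map_add, map_smul]
  linear_combination (norm := module) h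

/-- `D_T(x,y)u = D(Tx,Ty)u - TV (2 lam D(Tx,Ty)u + D(x,Ty)u + D(Tx,y)u)`. -/
theorem Rep.IsReynolds.DT_apply (hT : A.IsReynolds lam T) (hV : R.IsReynolds lam T TV)
    (x y : L) (u : V) :
    (A.descendent hT).D (R.rhoT lam T TV) (R.thetaT lam T TV) x y u
      = R.D (T x) (T y) u
        - TV ((2 * lam) • R.D (T x) (T y) u + R.D x (T y) u + R.D (T x) y u) := by
  have hb : R.rhoT lam T TV ((A.descendent hT).br x y) u
      = R.rho (A.br (T x) (T y)) u - TV (lam • R.rho (A.br (T x) (T y)) u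
        + R.rho (A.br (T x) y + A.br x (T y) + lam • A.br (T x) (T y)) u) := by
    change R.rhoT lam T TV (A.brT lam T x y) u = _
    rw [R.rhoT_apply, hT.map_brT, A.brT_apply]
  have hr : ∀ x y, R.rhoT lam T TV x (R.rhoT lam T TV y u)
      = R.rhoT lam T TV x (R.rho (T y) u)
        - TV (R.rho (T x) (lam • R.rho (T y) u + R.rho y u)) := by
    intro x y
    rw [R.rhoT_apply lam T TV y u, map_sub, hV.rhoT_map]
  rw [LieYamaguti.D_apply, hb, hr, hr]
  simp only [Rep.D, LieYamaguti.D_apply, R.rhoT_apply, R.thetaT_apply, map_add, map_sub, map_smul,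
    LinearMap.add_apply, LinearMap.smul_apply]
  module

theorem Rep.IsReynolds.DT_map (hT : A.IsReynolds lam T) (hV : R.IsReynolds lam T TV)
    (x y : L) (u : V) :
    (A.descendent hT).D (R.rhoT lam T TV) (R.thetaT lam T TV) x y (TV u)
      = TV (R.D (T x) (T y) u) := by
  have hb : R.rhoT lam T TV ((A.descendent hT).br x y) (TV u)
      = TV (R.rho (A.br (T x) (T y)) u) := by
    rw [hV.rhoT_map]
    exact congrArg (fun w => TV (R.rho w u)) (hT.map_brT x y)
  simp only [LieYamaguti.D_apply, Rep.D, hb, hV.rhoT_map, hV.thetaT_map, map_add, map_sub]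

/-- The representation `(V; ρ_T, θ_T)` of the descendent algebra `L_T`. -/
noncomputable def Rep.descendent (R : Rep A V) (hT : A.IsReynolds lam T)
    (hV : R.IsReynolds lam T TV) : Rep (A.descendent hT) V where
  rho := R.rhoT lam T TV
  theta := R.thetaT lam T TV
  r1 x y a := by
    have e := fun x y a u => LinearMap.congr_fun (R.r1 x y a) u
    simp only [LinearMap.sub_apply, Module.End.mul_apply] at e
    ext u
    change R.thetaT lam T TV (A.brT lam T x y) a u = _
    simp only [LinearMap.sub_apply, Module.End.mul_apply]
    rw [R.thetaT_apply, hT.map_brT, R.rhoT_apply lam T TV y u, R.rhoT_apply lam T TV x u,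
      map_sub, map_sub, hV.thetaT_map, hV.thetaT_map]
    simp only [R.thetaT_apply, A.brT_apply, map_add, map_smul, LinearMap.add_apply,
      LinearMap.smul_apply, e, map_sub]
    module
  r2 a b x := by
    have e := fun a b x u => LinearMap.congr_fun (R.r2 a b x) u
    simp only [Rep.D_def, LinearMap.add_apply, Module.End.mul_apply] at e
    ext u
    simp only [LinearMap.add_apply, Module.End.mul_apply]
    change _ = _ + R.rhoT lam T TV (A.trT lam T a b x) u
    rw [R.rhoT_apply lam T TV x u, map_sub, hV.DT_map hT, hV.DT_apply hT, hV.DT_apply hT,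
      R.rhoT_apply lam T TV (A.trT lam T a b x), hT.map_trT, map_sub, hV.rhoT_map]
    simp only [R.rhoT_apply, A.trT_apply, map_add, map_smul, LinearMap.add_apply,
      LinearMap.smul_apply, e, map_sub]
    module
  r3 x a b := by
    have e := fun x a b u => LinearMap.congr_fun (R.r3 x a b) u
    simp only [LinearMap.sub_apply, Module.End.mul_apply] at e
    ext u
    change R.thetaT lam T TV x (A.brT lam T a b) u = _
    simp only [LinearMap.sub_apply, Module.End.mul_apply]
    rw [R.thetaT_apply, hT.map_brT, R.thetaT_apply lam T TV x b, R.thetaT_apply lam T TV x a,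
      map_sub, map_sub, hV.rhoT_map, hV.rhoT_map]
    simp only [R.rhoT_apply, A.brT_apply, map_add, map_smul, LinearMap.add_apply,
      LinearMap.smul_apply, e, map_sub]
    module
  r4 a b x y := by
    have e := fun a b x y u => LinearMap.congr_fun (R.r4 a b x y) u
    simp only [Rep.D_def, LinearMap.add_apply, Module.End.mul_apply] at e
    ext u
    simp only [LinearMap.add_apply, Module.End.mul_apply]
    change _ = _ + R.thetaT lam T TV (A.trT lam T a b x) y u
      + R.thetaT lam T TV x (A.trT lam T a b y) u
    rw [R.thetaT_apply lam T TV x y u, map_sub, hV.DT_map hT, hV.DT_apply hT, hV.DT_apply hT,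
      R.thetaT_apply lam T TV (A.trT lam T a b x), R.thetaT_apply lam T TV x (A.trT lam T a b y),
      hT.map_trT, hT.map_trT, map_sub, hV.thetaT_map]
    simp only [R.thetaT_apply, A.trT_apply, map_add, map_smul, LinearMap.add_apply,
      LinearMap.smul_apply, e, map_sub]
    module
  r5 a x y z := by
    have e := fun a x y z u => LinearMap.congr_fun (R.r5 a x y z) u
    simp only [Rep.D_def, LinearMap.add_apply, LinearMap.sub_apply, Module.End.mul_apply] at e
    ext u
    simp only [LinearMap.add_apply, LinearMap.sub_apply, Module.End.mul_apply]
    change R.thetaT lam T TV a (A.trT lam T x y z) u = _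
    rw [R.thetaT_apply, hT.map_trT, R.thetaT_apply lam T TV a x u, R.thetaT_apply lam T TV a y u,
      R.thetaT_apply lam T TV a z u, map_sub, map_sub, map_sub, hV.DT_map hT, hV.thetaT_map,
      hV.thetaT_map, hV.DT_apply hT]
    simp only [R.thetaT_apply, A.trT_apply, map_add, map_smul, LinearMap.add_apply,
      LinearMap.smul_apply, e, map_sub]
    module

end

end Reynolds

section Cohomology

variable {K L V : Type*} [Field K] [AddCommGroup L] [Module K L] [AddCommGroup V] [Module K V]

/-- For `n ≥ 1`, the space `C^{n+1}(L,V)` of pairs `(f, g)` with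
`f ∈ Hom(⋀²L ⊗ ⋯ ⊗ ⋀²L, V)` and `g ∈ Hom(⋀²L ⊗ ⋯ ⊗ ⋀²L ⊗ L, V)` (`n` factors `⋀²L`).
Linear maps out of a tensor product are written as multilinear maps, and the last argument of
`g`, in `L`, is curried. The space `C^1(L,V)` is `L →ₗ[K] V`. -/
abbrev Cochain (K L V : Type*) [Field K] [AddCommGroup L] [Module K L] [AddCommGroup V]
    [Module K V] (n : ℕ) :=
  MultilinearMap K (fun _ : Fin n => ⋀[K]^2 L) V ×
    MultilinearMap K (fun _ : Fin n => ⋀[K]^2 L) (L →ₗ[K] V)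

section CharZero

variable [CharZero K]

theorem eq_zero_of_eq_neg {M : Type*} [AddCommGroup M] [Module K M] {v : M} (h : v = -v) :
    v = 0 := by
  have h2 : (2 : K) • v = 0 := by
    rw [two_smul]
    nth_rewrite 2 [h]
    exact add_neg_cancel v
  exact (smul_eq_zero.mp h2).resolve_left two_ne_zero

theorem LieYamaguti.br_self (A : LieYamaguti K L) (x : L) : A.br x x = 0 :=
  eq_zero_of_eq_neg (K := K) (A.ly1 x x)

/-- The action `(x ∧ y) ↦ (z ↦ {x, y, z})` of `⋀² L` on `L`. -/
noncomputable def LieYamaguti.act (A : LieYamaguti K L) : ⋀[K]^2 L →ₗ[K] (L →ₗ[K] L) :=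
  liftWedge A.tr (fun x => by ext z; exact eq_zero_of_eq_neg (K := K) (A.ly2 x x z))

@[simp] theorem LieYamaguti.act_wedge (A : LieYamaguti K L) (x y : L) :
    A.act (wedge x y) = A.tr x y := liftWedge_wedge _ _ _ _

/-- The action `(x ∧ y) · (z ∧ w) = {x,y,z} ∧ w + z ∧ {x,y,w}` of `⋀² L` on `⋀² L`. -/
noncomputable def LieYamaguti.actWedge (A : LieYamaguti K L) :
    ⋀[K]^2 L →ₗ[K] (⋀[K]^2 L →ₗ[K] ⋀[K]^2 L) :=
  wedgeDer ∘ₗ A.act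

@[simp] theorem LieYamaguti.actWedge_wedge (A : LieYamaguti K L) (x y z w : L) :
    A.actWedge (wedge x y) (wedge z w) = wedge (A.tr x y z) w + wedge z (A.tr x y w) := by
  simp [LieYamaguti.actWedge]

variable {A : LieYamaguti K L}

/-- `x ∧ y ↦ D(x, y)`. -/
noncomputable def Rep.DW (R : Rep A V) : ⋀[K]^2 L →ₗ[K] Module.End K V :=
  liftWedge R.D (fun x => by ext u; simp [Rep.D, LieYamaguti.D_apply, A.br_self])

@[simp] theorem Rep.DW_wedge (R : Rep A V) (x y : L) : R.DW (wedge x y) = R.D x y :=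
  liftWedge_wedge _ _ _ _

/-- `h ↦ (x ∧ y ↦ ρ(x)h(y) - ρ(y)h(x) - h([x,y]))`. -/
noncomputable def Rep.endI (R : Rep A V) : (L →ₗ[K] V) →ₗ[K] (⋀[K]^2 L →ₗ[K] V) where
  toFun h := liftWedge
    (LinearMap.mk₂ K (fun x y => R.rho x (h y) - R.rho y (h x) - h (A.br x y))
      (by intro x x' y; simp only [map_add, LinearMap.add_apply]; abel)
      (by intro c x y; simp only [map_smul, LinearMap.smul_apply, smul_sub])
      (by intro x y y'; simp only [map_add, LinearMap.add_apply]; abel)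
      (by intro c x y; simp only [map_smul, LinearMap.smul_apply, smul_sub]))
    (fun x => by simp [A.br_self])
  map_add' h h' := wedge_hom_ext fun x y => by
    simp only [liftWedge_wedge, LinearMap.mk₂_apply, LinearMap.add_apply, map_add]; abel
  map_smul' c h := wedge_hom_ext fun x y => by
    simp only [liftWedge_wedge, LinearMap.mk₂_apply, LinearMap.smul_apply, map_smul,
      RingHom.id_apply, smul_sub]

@[simp] theorem Rep.endI_wedge (R : Rep A V) (h : L →ₗ[K] V) (x y : L) :
    R.endI h (wedge x y) = R.rho x (h y) - R.rho y (h x) - h (A.br x y) := by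
  simp [Rep.endI]

/-- `h ↦ (x ∧ y ↦ (z ↦ θ(y,z)h(x) - θ(x,z)h(y)))`. -/
noncomputable def Rep.endII (R : Rep A V) :
    (L →ₗ[K] V) →ₗ[K] (⋀[K]^2 L →ₗ[K] (L →ₗ[K] V)) where
  toFun h := liftWedge
    (LinearMap.mk₂ K (fun x y => (R.theta y).flip (h x) - (R.theta x).flip (h y))
      (by intro x x' y; ext z
          simp only [map_add, LinearMap.add_apply, LinearMap.sub_apply, LinearMap.flip_apply]; abel)
      (by intro c x y; ext z
          simp only [map_smul, LinearMap.smul_apply, LinearMap.sub_apply, LinearMap.flip_apply,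
            smul_sub])
      (by intro x y y'; ext z
          simp only [map_add, LinearMap.add_apply, LinearMap.sub_apply, LinearMap.flip_apply]; abel)
      (by intro c x y; ext z
          simp only [map_smul, LinearMap.smul_apply, LinearMap.sub_apply, LinearMap.flip_apply,
            smul_sub]))
    (fun x => by simp)
  map_add' h h' := wedge_hom_ext fun x y => by
    simp only [liftWedge_wedge, LinearMap.mk₂_apply, LinearMap.add_apply, map_add]; abel
  map_smul' c h := wedge_hom_ext fun x y => by
    simp only [liftWedge_wedge, LinearMap.mk₂_apply, LinearMap.smul_apply, map_smul,
      RingHom.id_apply, smul_sub]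

@[simp] theorem Rep.endII_wedge (R : Rep A V) (h : L →ₗ[K] V) (x y z : L) :
    R.endII h (wedge x y) z = R.theta y z (h x) - R.theta x z (h y) := by
  simp [Rep.endII]

end CharZero

section Pieces

variable {W M N : Type*} [AddCommGroup W] [Module K W] [AddCommGroup M] [Module K M]
  [AddCommGroup N] [Module K N] {n : ℕ}

/-- `(X_1, …, X_{n+1}) ↦ B (f (X_1, …, X_n)) X_{n+1}`. -/
noncomputable def lastTerm (B : M →ₗ[K] (W →ₗ[K] N))
    (f : MultilinearMap K (fun _ : Fin n => W) M) :
    MultilinearMap K (fun _ : Fin (n + 1) => W) N :=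
  MultilinearMap.uncurryRight (B.compMultilinearMap f)

@[simp] theorem lastTerm_apply (B : M →ₗ[K] (W →ₗ[K] N))
    (f : MultilinearMap K (fun _ : Fin n => W) M) (X : Fin (n + 1) → W) :
    lastTerm B f X = B (f (Fin.init X)) (X (Fin.last n)) := rfl

/-- `(X_1, …, X_{n+1}) ↦ B X_k (f (X_1, …, X_k omitted, …, X_{n+1}))`. -/
noncomputable def omitTerm (B : W →ₗ[K] (M →ₗ[K] N)) (k : Fin (n + 1))
    (f : MultilinearMap K (fun _ : Fin n => W) M) :
    MultilinearMap K (fun _ : Fin (n + 1) => W) N :=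
  LinearMap.uncurryMid k
    { toFun := fun w => (B w).compMultilinearMap f
      map_add' := fun w w' => by ext; simp
      map_smul' := fun c w => by ext; simp }

@[simp] theorem omitTerm_apply (B : W →ₗ[K] (M →ₗ[K] N)) (k : Fin (n + 1))
    (f : MultilinearMap K (fun _ : Fin n => W) M) (X : Fin (n + 1) → W) :
    omitTerm B k f X = B (X k) (f (k.removeNth X)) := rfl

/-- `(X_1, …, X_{n+1}) ↦ f (X_1, …, X_k omitted, …, B X_k X_l, …, X_{n+1})`, where `B X_k X_l`
stands in the place of `X_l`, for `l ≠ k`. -/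
noncomputable def moveTerm (B : W →ₗ[K] (W →ₗ[K] W)) (k l : Fin (n + 1)) (hkl : l ≠ k)
    (f : MultilinearMap K (fun _ : Fin n => W) M) :
    MultilinearMap K (fun _ : Fin (n + 1) => W) M :=
  MultilinearMap.mk' (fun X => f (k.removeNth (Function.update X l (B (X k) (X l)))))
    (by
      obtain ⟨j, rfl⟩ := Fin.exists_succAbove_eq hkl
      intro X i x y
      simp only [Fin.removeNth_update_succAbove]
      cases i using Fin.succAboveCases k with
      | x => simp
      | p i =>
        by_cases hij : i = j
        · subst hij; simp
        · have hne : k.succAbove j ≠ k.succAbove i := fun h =>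
            hij (Fin.succAbove_right_injective h).symm
          simp [Function.update_of_ne hne, Function.update_comm hij])
    (by
      obtain ⟨j, rfl⟩ := Fin.exists_succAbove_eq hkl
      intro X i c x
      simp only [Fin.removeNth_update_succAbove]
      cases i using Fin.succAboveCases k with
      | x => simp
      | p i =>
        by_cases hij : i = j
        · subst hij; simp
        · have hne : k.succAbove j ≠ k.succAbove i := fun h =>
            hij (Fin.succAbove_right_injective h).symm
          simp [Function.update_of_ne hne, Function.update_comm hij])

@[simp] theorem moveTerm_apply (B : W →ₗ[K] (W →ₗ[K] W)) (k l : Fin (n + 1)) (hkl : l ≠ k)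
    (f : MultilinearMap K (fun _ : Fin n => W) M) (X : Fin (n + 1) → W) :
    moveTerm B k l hkl f X = f (k.removeNth (Function.update X l (B (X k) (X l)))) := rfl

end Pieces

section Coboundary

variable [CharZero K] {A : LieYamaguti K L}

/-- The coboundary `δ^1 : C^1(L,V) → C^2(L,V)`. -/
noncomputable def Rep.delta1 (R : Rep A V) : (L →ₗ[K] V) →ₗ[K] Cochain K L V 1 where
  toFun f :=
    (MultilinearMap.ofSubsingleton K (⋀[K]^2 L) V (0 : Fin 1) (R.endI f),
     MultilinearMap.ofSubsingleton K (⋀[K]^2 L) (L →ₗ[K] V) (0 : Fin 1)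
      (((LinearMap.llcomp K L V V).flip f ∘ₗ R.DW) + R.endII f
        - (LinearMap.llcomp K L L V f ∘ₗ A.act)))
  map_add' f f' := by
    ext X
    · simp
    · simp only [MultilinearMap.ofSubsingleton_apply_apply, Prod.snd_add, add_apply,
        LinearMap.add_apply, LinearMap.sub_apply, map_add, LinearMap.add_comp]
      abel
  map_smul' c f := by
    ext X
    · simp
    · simp only [MultilinearMap.ofSubsingleton_apply_apply, Prod.smul_snd,
        smul_apply, LinearMap.add_apply, LinearMap.sub_apply, LinearMap.smul_apply,
        map_smul, LinearMap.smul_comp, RingHom.id_apply, smul_add, smul_sub]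

/-- `δ^1_I(f)(x ∧ y) = ρ(x)f(y) - ρ(y)f(x) - f([x,y])`. -/
theorem Rep.delta1_fst_apply (R : Rep A V) (f : L →ₗ[K] V) (x y : L) :
    (R.delta1 f).1 ![wedge x y] = R.rho x (f y) - R.rho y (f x) - f (A.br x y) := by
  simp [Rep.delta1]

/-- `δ^1_II(f)(x ∧ y, z) = D(x,y)f(z) + θ(y,z)f(x) - θ(x,z)f(y) - f({x,y,z})`. -/
theorem Rep.delta1_snd_apply (R : Rep A V) (f : L →ₗ[K] V) (x y z : L) :
    (R.delta1 f).2 ![wedge x y] z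
      = R.D x y (f z) + R.theta y z (f x) - R.theta x z (f y) - f (A.tr x y z) := by
  simp [Rep.delta1, add_sub_assoc]

/-- The first component `δ_I(f,g)` of the coboundary of `(f, g)`. Indices start at `0` here, so
the omitted index `k` carries the sign `(-1)^k` where the `1`-based formula has `(-1)^{k+1}`. -/
noncomputable def Rep.deltaI (R : Rep A V) (n : ℕ) (c : Cochain K L V n) :
    MultilinearMap K (fun _ : Fin (n + 1) => ⋀[K]^2 L) V :=
  ((-1 : K) ^ n) • lastTerm R.endI c.2
    + ∑ k : Fin n, ((-1 : K) ^ (k : ℕ)) • omitTerm R.DW k.castSucc c.1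
    + ∑ k : Fin (n + 1), ∑ l : {l : Fin (n + 1) // k < l},
        ((-1 : K) ^ ((k : ℕ) + 1)) • moveTerm A.actWedge k l.1 l.2.ne' c.1

/-- The second component `δ_II(f,g)` of the coboundary of `(f, g)`; it depends on `g` only. -/
noncomputable def Rep.deltaII (R : Rep A V) (n : ℕ) (c : Cochain K L V n) :
    MultilinearMap K (fun _ : Fin (n + 1) => ⋀[K]^2 L) (L →ₗ[K] V) :=
  ((-1 : K) ^ n) • lastTerm R.endII c.2
    + ∑ k : Fin (n + 1),
        ((-1 : K) ^ (k : ℕ)) • omitTerm (LinearMap.llcomp K L V V ∘ₗ R.DW) k c.2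
    + ∑ k : Fin (n + 1), ∑ l : {l : Fin (n + 1) // k < l},
        ((-1 : K) ^ ((k : ℕ) + 1)) • moveTerm A.actWedge k l.1 l.2.ne' c.2
    + ∑ k : Fin (n + 1),
        ((-1 : K) ^ ((k : ℕ) + 1)) • omitTerm ((LinearMap.llcomp K L L V).flip ∘ₗ A.act) k c.2

theorem Rep.deltaI_apply (R : Rep A V) (n : ℕ) (c : Cochain K L V n)
    (X : Fin (n + 1) → ⋀[K]^2 L) :
    R.deltaI n c X
      = ((-1 : K) ^ n) • R.endI (c.2 (Fin.init X)) (X (Fin.last n))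
        + ∑ k : Fin n, ((-1 : K) ^ (k : ℕ)) •
            R.DW (X k.castSucc) (c.1 (k.castSucc.removeNth X))
        + ∑ k : Fin (n + 1), ∑ l : {l : Fin (n + 1) // k < l}, ((-1 : K) ^ ((k : ℕ) + 1)) •
            c.1 (k.removeNth (Function.update X l.1 (A.actWedge (X k) (X l.1)))) := by
  simp [Rep.deltaI]

theorem Rep.deltaII_apply (R : Rep A V) (n : ℕ) (c : Cochain K L V n)
    (X : Fin (n + 1) → ⋀[K]^2 L) (z : L) :
    R.deltaII n c X z
      = ((-1 : K) ^ n) • R.endII (c.2 (Fin.init X)) (X (Fin.last n)) z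
        + ∑ k : Fin (n + 1), ((-1 : K) ^ (k : ℕ)) • R.DW (X k) (c.2 (k.removeNth X) z)
        + ∑ k : Fin (n + 1), ∑ l : {l : Fin (n + 1) // k < l}, ((-1 : K) ^ ((k : ℕ) + 1)) •
            c.2 (k.removeNth (Function.update X l.1 (A.actWedge (X k) (X l.1)))) z
        + ∑ k : Fin (n + 1), ((-1 : K) ^ ((k : ℕ) + 1)) •
            c.2 (k.removeNth X) (A.act (X k) z) := by
  simp [Rep.deltaII]

/-- For `n ≥ 1`, the coboundary `δ^{n+1} = (δ_I, δ_II) : C^{n+1}(L,V) → C^{n+2}(L,V)`. -/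
noncomputable def Rep.delta (R : Rep A V) (n : ℕ) :
    Cochain K L V n →ₗ[K] Cochain K L V (n + 1) where
  toFun c := (R.deltaI n c, R.deltaII n c)
  map_add' c c' := by
    refine Prod.ext (MultilinearMap.ext fun X => ?_)
      (MultilinearMap.ext fun X => LinearMap.ext fun z => ?_)
    · simp only [Prod.fst_add, add_apply, Rep.deltaI_apply, Prod.snd_add, map_add,
        LinearMap.add_apply, smul_add, Finset.sum_add_distrib]
      abel
    · simp only [Prod.snd_add, add_apply, LinearMap.add_apply, Rep.deltaII_apply,
        map_add, smul_add, Finset.sum_add_distrib]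
      abel
  map_smul' a c := by
    refine Prod.ext (MultilinearMap.ext fun X => ?_)
      (MultilinearMap.ext fun X => LinearMap.ext fun z => ?_)
    · simp only [Prod.smul_fst, smul_apply, Rep.deltaI_apply, Prod.smul_snd,
        map_smul, LinearMap.smul_apply, smul_add, Finset.smul_sum, RingHom.id_apply,
        smul_comm _ a]
    · simp only [smul_apply, Rep.deltaII_apply, Prod.smul_snd,
        map_smul, LinearMap.smul_apply, smul_add, Finset.smul_sum, RingHom.id_apply,
        smul_comm _ a]

end Coboundary

section ChainMap

/-- `Φ^1(f) = f ∘ T - TV ∘ f`. -/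
noncomputable def Phi1 (T : L →ₗ[K] L) (TV : V →ₗ[K] V) : (L →ₗ[K] V) →ₗ[K] (L →ₗ[K] V) where
  toFun f := f ∘ₗ T - TV ∘ₗ f
  map_add' f f' := by ext x; simp only [LinearMap.sub_apply, LinearMap.comp_apply,
    LinearMap.add_apply, map_add]; abel
  map_smul' c f := by ext x; simp [smul_sub]

/-- The tuple of maps `⋀² L → ⋀² L` with `x ∧ y ↦ x ∧ Ty + Tx ∧ y` in place `i` and
`x ∧ y ↦ Tx ∧ Ty` elsewhere. -/
noncomputable def oneFree (n : ℕ) (T : L →ₗ[K] L) (i : Fin n) :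
    Fin n → (⋀[K]^2 L →ₗ[K] ⋀[K]^2 L) :=
  Function.update (fun _ => exteriorPower.map 2 T) i (wedgeDer T)

/-- The first component of `Φ^{n+1}`, for `n ≥ 1`:
`f ∘ (T, …, T) - TV (∑_{i=1}^{2n} f ∘ (T, …, T, Id, T, …, T) + (2n-1) lam f ∘ (T, …, T))`,
with `Id` in place `i`. The summands `i = 2j-1` and `i = 2j` are taken together: their sum is
`f` composed with `x ∧ y ↦ x ∧ Ty + Tx ∧ y` in the `j`-th factor `⋀² L`. -/
noncomputable def PhiI (n : ℕ) (lam : K) (T : L →ₗ[K] L) (TV : V →ₗ[K] V)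
    (f : MultilinearMap K (fun _ : Fin n => ⋀[K]^2 L) V) :
    MultilinearMap K (fun _ : Fin n => ⋀[K]^2 L) V :=
  f.compLinearMap (fun _ => exteriorPower.map 2 T)
    - TV.compMultilinearMap (∑ i : Fin n, f.compLinearMap (oneFree n T i)
        + ((2 * (n : K) - 1) * lam) • f.compLinearMap (fun _ => exteriorPower.map 2 T))

/-- The second component of `Φ^{n+1}`, for `n ≥ 1`:
`g ∘ (T, …, T) - TV (∑_{i=1}^{2n+1} g ∘ (T, …, T, Id, T, …, T) + 2n lam g ∘ (T, …, T))`. The first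
`2n` summands are taken in pairs; the last one has `Id` on the factor `L`. -/
noncomputable def PhiII (n : ℕ) (lam : K) (T : L →ₗ[K] L) (TV : V →ₗ[K] V)
    (g : MultilinearMap K (fun _ : Fin n => ⋀[K]^2 L) (L →ₗ[K] V)) :
    MultilinearMap K (fun _ : Fin n => ⋀[K]^2 L) (L →ₗ[K] V) :=
  (LinearMap.lcomp K V T).compMultilinearMap (g.compLinearMap fun _ => exteriorPower.map 2 T)
    - (LinearMap.llcomp K L V V TV).compMultilinearMap
        (∑ i : Fin n, (LinearMap.lcomp K V T).compMultilinearMap (g.compLinearMap (oneFree n T i))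
          + g.compLinearMap (fun _ => exteriorPower.map 2 T)
          + (2 * (n : K) * lam) • (LinearMap.lcomp K V T).compMultilinearMap
              (g.compLinearMap fun _ => exteriorPower.map 2 T))

theorem PhiI_apply (n : ℕ) (lam : K) (T : L →ₗ[K] L) (TV : V →ₗ[K] V)
    (f : MultilinearMap K (fun _ : Fin n => ⋀[K]^2 L) V) (X : Fin n → ⋀[K]^2 L) :
    PhiI n lam T TV f X = f (fun j => exteriorPower.map 2 T (X j))
      - TV (∑ i : Fin n, f (fun j => oneFree n T i j (X j))
          + ((2 * (n : K) - 1) * lam) • f (fun j => exteriorPower.map 2 T (X j))) := by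
  simp [PhiI]

theorem PhiII_apply (n : ℕ) (lam : K) (T : L →ₗ[K] L) (TV : V →ₗ[K] V)
    (g : MultilinearMap K (fun _ : Fin n => ⋀[K]^2 L) (L →ₗ[K] V)) (X : Fin n → ⋀[K]^2 L)
    (z : L) :
    PhiII n lam T TV g X z = g (fun j => exteriorPower.map 2 T (X j)) (T z)
      - TV (∑ i : Fin n, g (fun j => oneFree n T i j (X j)) (T z)
          + g (fun j => exteriorPower.map 2 T (X j)) z
          + (2 * (n : K) * lam) • g (fun j => exteriorPower.map 2 T (X j)) (T z)) := by
  simp [PhiII]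

theorem map_wedge (T : L →ₗ[K] L) (x y : L) :
    exteriorPower.map 2 T (wedge x y : ⋀[K]^2 L) = wedge (T x) (T y) := by
  rw [wedge, exteriorPower.map_apply_ιMulti, wedge]
  congr 1
  ext i
  fin_cases i <;> rfl

theorem oneFree_wedge (n : ℕ) (T : L →ₗ[K] L) (i : Fin n) (x y : Fin n → L) :
    (fun j => oneFree n T i j (wedge (x j) (y j)))
      = Function.update (fun j => wedge (T (x j)) (T (y j))) i
          (wedge (T (x i)) (y i) + wedge (x i) (T (y i))) := by
  ext1 j
  by_cases h : j = i
  · subst h; simp [oneFree]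
  · simp [oneFree, h, map_wedge]

/-- The value of `Φ_I(f)` on decomposable elements, as a sum over all `2n` places of `Id`. -/
theorem PhiI_wedge (n : ℕ) (lam : K) (T : L →ₗ[K] L) (TV : V →ₗ[K] V)
    (f : MultilinearMap K (fun _ : Fin n => ⋀[K]^2 L) V) (x y : Fin n → L) :
    PhiI n lam T TV f (fun j => wedge (x j) (y j))
      = f (fun j => wedge (T (x j)) (T (y j)))
        - TV (∑ i : Fin n,
              (f (fun j => wedge (if j = i then x j else T (x j)) (T (y j)))
                + f (fun j => wedge (T (x j)) (if j = i then y j else T (y j))))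
            + ((2 * (n : K) - 1) * lam) • f (fun j => wedge (T (x j)) (T (y j)))) := by
  have h1 : ∀ i : Fin n, (fun j => (wedge (if j = i then x j else T (x j)) (T (y j)) : ⋀[K]^2 L))
      = Function.update (fun j => wedge (T (x j)) (T (y j))) i (wedge (x i) (T (y i))) := by
    intro i; ext1 j; by_cases h : j = i
    · subst h; simp
    · simp [h]
  have h2 : ∀ i : Fin n, (fun j => (wedge (T (x j)) (if j = i then y j else T (y j)) : ⋀[K]^2 L))
      = Function.update (fun j => wedge (T (x j)) (T (y j))) i (wedge (T (x i)) (y i)) := by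
    intro i; ext1 j; by_cases h : j = i
    · subst h; simp
    · simp [h]
  simp only [PhiI_apply, oneFree_wedge, map_wedge, MultilinearMap.map_update_add, h1, h2]
  simp only [add_comm]

/-- For `n ≥ 1`, the map `Φ^{n+1} = (Φ_I, Φ_II)` on `C^{n+1}(L,V)`. -/
noncomputable def Phi (n : ℕ) (lam : K) (T : L →ₗ[K] L) (TV : V →ₗ[K] V) :
    Cochain K L V n →ₗ[K] Cochain K L V n where
  toFun c := (PhiI n lam T TV c.1, PhiII n lam T TV c.2)
  map_add' c c' := by
    refine Prod.ext (MultilinearMap.ext fun X => ?_)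
      (MultilinearMap.ext fun X => LinearMap.ext fun z => ?_)
    · simp only [Prod.fst_add, add_apply, PhiI_apply, map_add,
        smul_add, Finset.sum_add_distrib]
      abel
    · simp only [Prod.snd_add, add_apply, LinearMap.add_apply, PhiII_apply,
        map_add, smul_add, Finset.sum_add_distrib]
      abel
  map_smul' a c := by
    refine Prod.ext (MultilinearMap.ext fun X => ?_)
      (MultilinearMap.ext fun X => LinearMap.ext fun z => ?_)
    · simp only [Prod.smul_fst, smul_apply, PhiI_apply, map_smul, smul_add,
        smul_sub, ← Finset.smul_sum, RingHom.id_apply, smul_comm _ a, map_add]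
    · simp only [Prod.smul_snd, smul_apply, PhiII_apply, map_smul, smul_add,
        LinearMap.smul_apply, smul_sub, ← Finset.smul_sum, RingHom.id_apply, smul_comm _ a,
        map_add]

end ChainMap

end Cohomology
end LieYam

/-!
The map `Φ` is the composite of two natural maps of complexes. Let `ε ^ 2 = 0` and
`S = T + ε (id + lam T)`. The Reynolds identities for `T` say exactly that `S` is a homomorphism
from the descendent algebra `L_T` to `L[ε]`; hence `L_T` acts on `V[ε]`, and pulling cochains
back along `S` is a cochain map `C(L, V) → C(L_T, V[ε])`. The Reynolds identities for `TV` say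
that `q : V[ε] → V`, `u + ε v ↦ u - TV (v - lam u)`, is a morphism of representations of `L_T`,
where `V` carries `(ρ_T, θ_T)`. Pushing forward along `q` after pulling back along `S` gives `Φ`:
the `ε`-coefficient of `f ∘ (S, …, S)` for `f` of `m` arguments is
`∑ i, f ∘ (T, …, id, …, T) + m lam f ∘ (T, …, T)`, and `q` removes one `lam`.

The proof carries this out without forming `V[ε]`. On the factors `⋀² L` the pair of
coefficients of `S` is `⋀² T` and `wedgeDeriv lam T`. The operation `twist a d P Q` sends a
multilinear map `f` to `P (f ∘ (a, …, a)) - Q (∑ i, f ∘ (a, …, d, …, a))`, and both components of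
`Φ` have this form (`PhiI_eq_twist`, `PhiII_eq_twist`). Each summand of the coboundary is a
`lastTerm`, an `omitTerm` or a `moveTerm`, and `twist_lastTerm`, `twist_omitTerm`,
`twist_moveTerm` show that `twist` carries such a term to the corresponding term for `L_T`,
provided the bilinear map defining it satisfies two identities that express the equivariance of
`q`, or the homomorphism property of `S`. These identities involve only a single `x ∧ y`, and
are verified for each of the structure maps.
-/

namespace LieYam

/-! ### The first-order twist of a multilinear map -/

section Twist

variable {K W M M' N N' : Type*} [Field K] [AddCommGroup W] [Module K W]
  [AddCommGroup M] [Module K M] [AddCommGroup M'] [Module K M']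
  [AddCommGroup N] [Module K N] [AddCommGroup N'] [Module K N'] {n : ℕ}

/-- `f ↦ P (f ∘ (a, …, a)) - Q (∑ i, f ∘ (a, …, d, …, a))`, with `d` in place `i`: the two
coefficients of `f ∘ (a + ε d, …, a + ε d)`, where `ε ^ 2 = 0`, combined by `P` and `-Q`. -/
noncomputable def twist (a d : W →ₗ[K] W) (P Q : M →ₗ[K] M') :
    MultilinearMap K (fun _ : Fin n => W) M →ₗ[K] MultilinearMap K (fun _ : Fin n => W) M' where
  toFun f := P.compMultilinearMap (f.compLinearMap fun _ => a)
    - Q.compMultilinearMap (∑ i : Fin n, f.compLinearMap (Function.update (fun _ => a) i d))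
  map_add' f g := by
    ext X
    simp only [sub_apply, LinearMap.compMultilinearMap_apply,
      MultilinearMap.compLinearMap_apply, add_apply, sum_apply,
      map_add, Finset.sum_add_distrib]
    abel
  map_smul' c f := by
    ext X
    simp only [sub_apply, LinearMap.compMultilinearMap_apply,
      MultilinearMap.compLinearMap_apply, smul_apply, sum_apply,
      map_smul, ← Finset.smul_sum, smul_sub, RingHom.id_apply]

theorem update_const_apply (a d : W →ₗ[K] W) (i : Fin n) (X : Fin n → W) :
    (fun j => Function.update (fun _ => a) i d j (X j))
      = Function.update (fun j => a (X j)) i (d (X i)) := by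
  ext1 j
  by_cases h : j = i
  · subst h; simp
  · simp [h]

theorem twist_apply (a d : W →ₗ[K] W) (P Q : M →ₗ[K] M')
    (f : MultilinearMap K (fun _ : Fin n => W) M) (X : Fin n → W) :
    twist a d P Q f X = P (f fun j => a (X j))
      - Q (∑ i, f (Function.update (fun j => a (X j)) i (d (X i)))) := by
  simp [twist, update_const_apply]

theorem twist_ofSubsingleton (a d : W →ₗ[K] W) (P Q : M →ₗ[K] M') (B : W →ₗ[K] M) :
    twist a d P Q (MultilinearMap.ofSubsingleton K W M (0 : Fin 1) B)
      = MultilinearMap.ofSubsingleton K W M' (0 : Fin 1) (P ∘ₗ B ∘ₗ a - Q ∘ₗ B ∘ₗ d) := by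
  ext X
  simp [twist_apply]

/-- The Leibniz rule for the last argument, combined with the equivariance of `(P, Q)`. -/
theorem twist_lastTerm {a d : W →ₗ[K] W} {P Q : M →ₗ[K] M'} {P₁ Q₁ : N →ₗ[K] N'}
    {B : M →ₗ[K] (W →ₗ[K] N)} {B' : M' →ₗ[K] (W →ₗ[K] N')}
    (hP : ∀ h Y, B' (P h) Y = P₁ (B h (a Y)) - Q₁ (B h (d Y)))
    (hQ : ∀ h Y, B' (Q h) Y = Q₁ (B h (a Y)))
    (f : MultilinearMap K (fun _ : Fin n => W) M) :
    twist a d P₁ Q₁ (lastTerm B f) = lastTerm B' (twist a d P Q f) := by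
  ext X
  have hlast : Fin.init (Function.update (fun j => a (X j)) (Fin.last n) (d (X (Fin.last n))))
      = Fin.init fun j => a (X j) := Fin.init_update_last _ _
  have hinit : ∀ i : Fin n,
      Fin.init (Function.update (fun j => a (X j)) i.castSucc (d (X i.castSucc)))
        = Function.update (fun j => a (Fin.init X j)) i (d (Fin.init X i)) :=
    fun i => Fin.init_update_castSucc _ _ _
  simp only [twist_apply, lastTerm_apply, Fin.sum_univ_castSucc, hlast, hinit, map_add, map_sub,
    LinearMap.sub_apply, hP, hQ, map_sum, LinearMap.sum_apply, Function.update_self,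
    Function.update_of_ne (Fin.castSucc_lt_last _).ne']
  have : (Fin.init fun j => a (X j)) = fun j => a (Fin.init X j) := rfl
  rw [this]
  abel

/-- The Leibniz rule for the argument in place `k`, combined with the equivariance of
`(P, Q)`. -/
theorem twist_omitTerm {a d : W →ₗ[K] W} {P Q : M →ₗ[K] M'} {P₁ Q₁ : N →ₗ[K] N'}
    {B : W →ₗ[K] (M →ₗ[K] N)} {B' : W →ₗ[K] (M' →ₗ[K] N')}
    (hP : ∀ Y h, B' Y (P h) = P₁ (B (a Y) h) - Q₁ (B (d Y) h))
    (hQ : ∀ Y h, B' Y (Q h) = Q₁ (B (a Y) h))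
    (k : Fin (n + 1)) (f : MultilinearMap K (fun _ : Fin n => W) M) :
    twist a d P₁ Q₁ (omitTerm B k f) = omitTerm B' k (twist a d P Q f) := by
  ext X
  have hk : k.removeNth (fun j => a (X j)) = fun j => a (k.removeNth X j) := rfl
  simp only [twist_apply, omitTerm_apply, Fin.sum_univ_succAbove _ k, Fin.removeNth_update,
    Fin.removeNth_update_succAbove, map_add, map_sub, hP, hQ, map_sum, Function.update_self,
    Function.update_of_ne (Fin.ne_succAbove k _), hk]
  simp only [Fin.removeNth_apply]
  abel

/-- A derivation property of the pair `(a, d)` makes `twist` compatible with the insertion of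
`B X_k X_l` in the place of `X_l`. -/
theorem twist_moveTerm {a d : W →ₗ[K] W} {P Q : M →ₗ[K] M'}
    {B B' : W →ₗ[K] (W →ₗ[K] W)}
    (ha : ∀ Y Z, a (B' Y Z) = B (a Y) (a Z))
    (hd : ∀ Y Z, d (B' Y Z) = B (d Y) (a Z) + B (a Y) (d Z))
    (k l : Fin (n + 1)) (hkl : l ≠ k) (f : MultilinearMap K (fun _ : Fin n => W) M) :
    twist a d P Q (moveTerm B k l hkl f) = moveTerm B' k l hkl (twist a d P Q f) := by
  obtain ⟨m, rfl⟩ := Fin.exists_succAbove_eq hkl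
  ext X
  have hk : k.removeNth (fun j => a (X j)) = fun j => a (k.removeNth X j) := rfl
  have hcomp : ∀ w : W, (fun j => a (Function.update (k.removeNth X) m w j))
      = Function.update (fun j => a (k.removeNth X j)) m (a w) :=
    fun w => Function.comp_update a _ _ _
  simp only [twist_apply, moveTerm_apply, Fin.removeNth_update_succAbove, hcomp, ha, hk]
  congr 2
  -- On the left, the summands with `d` in places `k` and `l` add up, by `hd`, to the summand
  -- `i = m` on the right, where `l = k.succAbove m`; the others correspond one to one.
  rw [Fin.sum_univ_succAbove _ k]
  rw [← Finset.add_sum_erase _ _ (Finset.mem_univ m),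
    ← Finset.add_sum_erase (a := m) (s := Finset.univ) (f := fun i => f (Function.update
      (Function.update (fun j => a (k.removeNth X j)) m _) i _)) (Finset.mem_univ m)]
  rw [← add_assoc]
  congr 1
  · simp [Fin.removeNth_update_succAbove, hd, hk]
  · refine Finset.sum_congr rfl fun i hi => ?_
    have hne : i ≠ m := Finset.ne_of_mem_erase hi
    have hne' : k.succAbove m ≠ k.succAbove i :=
      fun h => hne (Fin.succAbove_right_injective h).symm
    simp [Fin.removeNth_update_succAbove, hk, Function.update_of_ne hne,
      Function.update_of_ne hne', Function.update_comm hne, Fin.removeNth_apply]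

end Twist

/-! ### Exterior squares and the Reynolds operator -/

section Structure

variable {K L V : Type*} [Field K] [AddCommGroup L] [Module K L] [AddCommGroup V] [Module K V]

theorem wedge_add_left (x x' y : L) :
    (wedge (x + x') y : ⋀[K]^2 L) = wedge x y + wedge x' y :=
  LinearMap.map_add₂ wedgeBilin x x' y

theorem wedge_add_right (x y y' : L) :
    (wedge x (y + y') : ⋀[K]^2 L) = wedge x y + wedge x y' :=
  map_add (wedgeBilin x) y y'

theorem wedge_smul_left (c : K) (x y : L) : (wedge (c • x) y : ⋀[K]^2 L) = c • wedge x y :=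
  LinearMap.map_smul₂ wedgeBilin c x y

theorem wedge_smul_right (c : K) (x y : L) : (wedge x (c • y) : ⋀[K]^2 L) = c • wedge x y :=
  map_smul (wedgeBilin x) c y

/-- No hypothesis on scalar multiples is needed, since `c • (x ∧ y) = (c • x) ∧ y`. -/
theorem wedge_induction {p : ⋀[K]^2 L → Prop} (wedge : ∀ x y, p (wedge x y))
    (add : ∀ X Y, p X → p Y → p (X + Y)) (X : ⋀[K]^2 L) : p X := by
  have hX : X ∈ Submodule.span K (Set.range (exteriorPower.ιMulti K 2 (M := L))) := by
    rw [exteriorPower.ιMulti_span]; trivial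
  have hw : ∀ v : Fin 2 → L, exteriorPower.ιMulti K 2 v = LieYam.wedge (v 0) (v 1) := by
    intro v
    have hv : v = ![v 0, v 1] := by ext i; fin_cases i <;> rfl
    rw [hv]; rfl
  induction hX using Submodule.closure_induction with
  | zero =>
    have h := wedge 0 0
    rwa [wedge_self] at h
  | add X Y _ _ hX hY => exact add X Y hX hY
  | smul_mem c X hX =>
    obtain ⟨v, rfl⟩ := hX
    rw [hw, ← wedge_smul_left]
    exact wedge _ _

/-- The `ε`-coefficient of `⋀² (T + ε (id + lam T))`, where `ε ^ 2 = 0`. -/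
noncomputable def wedgeDeriv (lam : K) (T : L →ₗ[K] L) : ⋀[K]^2 L →ₗ[K] ⋀[K]^2 L :=
  wedgeDer T + (2 * lam) • exteriorPower.map 2 T

theorem wedgeDeriv_wedge (lam : K) (T : L →ₗ[K] L) (x y : L) :
    wedgeDeriv lam T (wedge x y)
      = wedge (T x) y + wedge x (T y) + (2 * lam) • wedge (T x) (T y) := by
  simp [wedgeDeriv, map_wedge]

/-! ### The two components of `Φ` as twists -/

/-- `h ↦ TV ∘ h ∘ T`, the map that `Φ_II` applies to the `ε`-coefficient along `⋀² L`. -/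
noncomputable def sandwich (T : L →ₗ[K] L) (TV : V →ₗ[K] V) : (L →ₗ[K] V) →ₗ[K] (L →ₗ[K] V) :=
  LinearMap.llcomp K L V V TV ∘ₗ LinearMap.lcomp K V T

theorem sandwich_apply (T : L →ₗ[K] L) (TV : V →ₗ[K] V) (h : L →ₗ[K] V) (z : L) :
    sandwich T TV h z = TV (h (T z)) := rfl

theorem Phi1_apply (T : L →ₗ[K] L) (TV : V →ₗ[K] V) (h : L →ₗ[K] V) (z : L) :
    Phi1 T TV h z = h (T z) - TV (h z) := rfl

theorem oneFree_apply (n : ℕ) (T : L →ₗ[K] L) (i : Fin n) (X : Fin n → ⋀[K]^2 L) :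
    (fun j => oneFree n T i j (X j))
      = Function.update (fun j => exteriorPower.map 2 T (X j)) i (wedgeDer T (X i)) :=
  update_const_apply _ _ _ _

/-- Replacing `wedgeDer T` by `wedgeDeriv lam T` in each of the `n` places adds `2 n lam` times
the value at `(⋀² T, …, ⋀² T)`. -/
theorem sum_update_wedgeDeriv {M : Type*} [AddCommGroup M] [Module K M] {n : ℕ} (lam : K)
    (T : L →ₗ[K] L) (f : MultilinearMap K (fun _ : Fin n => ⋀[K]^2 L) M)
    (X : Fin n → ⋀[K]^2 L) :
    ∑ i, f (Function.update (fun j => exteriorPower.map 2 T (X j)) i (wedgeDeriv lam T (X i)))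
      = ∑ i, f (fun j => oneFree n T i j (X j))
        + (2 * (n : K) * lam) • f (fun j => exteriorPower.map 2 T (X j)) := by
  have h : ∀ i, f (Function.update (fun j => exteriorPower.map 2 T (X j)) i
        (exteriorPower.map 2 T (X i))) = f fun j => exteriorPower.map 2 T (X j) := fun i => by
    rw [Function.update_eq_self i fun j => exteriorPower.map 2 T (X j)]
  simp only [oneFree_apply, wedgeDeriv, LinearMap.add_apply, LinearMap.smul_apply,
    MultilinearMap.map_update_add, MultilinearMap.map_update_smul, h, Finset.sum_add_distrib,
    Finset.sum_const, Finset.card_univ, Fintype.card_fin, ← Nat.cast_smul_eq_nsmul K, smul_smul]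
  congr 2
  ring

theorem PhiI_eq_twist (n : ℕ) (lam : K) (T : L →ₗ[K] L) (TV : V →ₗ[K] V)
    (f : MultilinearMap K (fun _ : Fin n => ⋀[K]^2 L) V) :
    PhiI n lam T TV f
      = twist (exteriorPower.map 2 T) (wedgeDeriv lam T) (LinearMap.id + lam • TV) TV f := by
  ext X
  rw [PhiI_apply, twist_apply, sum_update_wedgeDeriv]
  simp only [LinearMap.add_apply, LinearMap.smul_apply, LinearMap.id_apply, map_add, map_smul]
  module

/-- The coefficients of `g ∘ (S, …, S)` involve `S` in the last argument, in `L`, as well; this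
accounts for `P` and `Q` here: `q (h (S z)) = h (T z) - TV (h z)` for `h : L → V`. -/
theorem PhiII_eq_twist (n : ℕ) (lam : K) (T : L →ₗ[K] L) (TV : V →ₗ[K] V)
    (g : MultilinearMap K (fun _ : Fin n => ⋀[K]^2 L) (L →ₗ[K] V)) :
    PhiII n lam T TV g
      = twist (exteriorPower.map 2 T) (wedgeDeriv lam T) (Phi1 T TV) (sandwich T TV) g := by
  ext X z
  rw [PhiII_apply, twist_apply, sum_update_wedgeDeriv]
  simp only [LinearMap.sub_apply, Phi1_apply, sandwich_apply, LinearMap.add_apply,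
    LinearMap.smul_apply, map_add, map_smul, LinearMap.sum_apply]
  module

variable [CharZero K] {A : LieYamaguti K L} {R : Rep A V} {lam : K} {T : L →ₗ[K] L}
  {TV : V →ₗ[K] V}

/-! ### Compatibility of the structure maps with the two coefficients of `T + ε (id + lam T)` -/

/-- The coefficient of `1` in the homomorphism property of `⋀² (T + ε (id + lam T))`. -/
theorem LieYamaguti.IsReynolds.map_actWedge (hT : A.IsReynolds lam T) (Y Z : ⋀[K]^2 L) :
    exteriorPower.map 2 T ((A.descendent hT).actWedge Y Z)
      = A.actWedge (exteriorPower.map 2 T Y) (exteriorPower.map 2 T Z) := by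
  induction Y using wedge_induction with
  | add Y Y' h h' => simp only [map_add, LinearMap.add_apply, h, h']
  | wedge x y =>
    induction Z using wedge_induction with
    | add Z Z' h h' => simp only [map_add, h, h']
    | wedge z w =>
      have e : ∀ c, T ((A.descendent hT).tr x y c) = A.tr (T x) (T y) (T c) := hT.map_trT x y
      simp only [actWedge_wedge, map_add, map_wedge, e]

/-- The coefficient of `ε` in the homomorphism property of `⋀² (T + ε (id + lam T))`. -/
theorem LieYamaguti.IsReynolds.wedgeDeriv_actWedge (hT : A.IsReynolds lam T) (Y Z : ⋀[K]^2 L) :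
    wedgeDeriv lam T ((A.descendent hT).actWedge Y Z)
      = A.actWedge (wedgeDeriv lam T Y) (exteriorPower.map 2 T Z)
        + A.actWedge (exteriorPower.map 2 T Y) (wedgeDeriv lam T Z) := by
  induction Y using wedge_induction with
  | add Y Y' h h' => simp only [map_add, LinearMap.add_apply, h, h']; abel
  | wedge x y =>
    induction Z using wedge_induction with
    | add Z Z' h h' => simp only [map_add, h, h']; abel
    | wedge z w =>
      have e : ∀ c, T ((A.descendent hT).tr x y c) = A.tr (T x) (T y) (T c) := hT.map_trT x y
      have e' : ∀ c, (A.descendent hT).tr x y c = _ := A.trT_apply lam T x y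
      simp only [actWedge_wedge, map_add, map_smul, map_wedge, wedgeDeriv_wedge, e,
        LinearMap.add_apply, LinearMap.smul_apply]
      simp only [e', wedge_add_left, wedge_add_right, wedge_smul_left, wedge_smul_right]
      module

theorem Rep.IsReynolds.DW_TV (hT : A.IsReynolds lam T) (hV : R.IsReynolds lam T TV)
    (Y : ⋀[K]^2 L) (u : V) :
    (R.descendent hT hV).DW Y (TV u) = TV (R.DW (exteriorPower.map 2 T Y) u) := by
  induction Y using wedge_induction with
  | add Y Y' h h' => simp only [map_add, LinearMap.add_apply, h, h']
  | wedge x y =>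
    rw [Rep.DW_wedge, map_wedge, Rep.DW_wedge]
    exact hV.DT_map hT x y u

/-- With `DW_TV`, the equivariance of `q` for the operators `D`. -/
theorem Rep.IsReynolds.DW_apply (hT : A.IsReynolds lam T) (hV : R.IsReynolds lam T TV)
    (Y : ⋀[K]^2 L) (u : V) :
    (R.descendent hT hV).DW Y u
      = R.DW (exteriorPower.map 2 T Y) u - TV (R.DW (wedgeDeriv lam T Y) u) := by
  induction Y using wedge_induction with
  | add Y Y' h h' => simp only [map_add, LinearMap.add_apply, h, h']; abel
  | wedge x y =>
    rw [Rep.DW_wedge, map_wedge, wedgeDeriv_wedge]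
    refine (hV.DT_apply hT x y u).trans ?_
    simp only [map_add, map_smul, LinearMap.add_apply, LinearMap.smul_apply, Rep.DW_wedge]
    module

theorem LieYamaguti.IsReynolds.map_act (hT : A.IsReynolds lam T) (Y : ⋀[K]^2 L) (z : L) :
    T ((A.descendent hT).act Y z) = A.act (exteriorPower.map 2 T Y) (T z) := by
  induction Y using wedge_induction with
  | add Y Y' h h' => simp only [map_add, LinearMap.add_apply, h, h']
  | wedge x y =>
    rw [act_wedge, map_wedge, act_wedge]
    exact hT.map_trT x y z

theorem LieYamaguti.IsReynolds.act_apply (hT : A.IsReynolds lam T) (Y : ⋀[K]^2 L) (z : L) :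
    (A.descendent hT).act Y z
      = A.act (exteriorPower.map 2 T Y) z + A.act (wedgeDeriv lam T Y) (T z) := by
  induction Y using wedge_induction with
  | add Y Y' h h' => simp only [map_add, LinearMap.add_apply, h, h']; abel
  | wedge x y =>
    rw [act_wedge, map_wedge, act_wedge, wedgeDeriv_wedge]
    refine (A.trT_apply lam T x y z).trans ?_
    simp only [map_add, map_smul, LinearMap.add_apply, LinearMap.smul_apply, act_wedge]
    module

/-- Equivariance of `q` for `ρ`, together with the homomorphism property of `S` for the bracket;
`id + lam TV` and `-TV` are the restrictions of `q` to the two summands of `V[ε]`. -/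
theorem endI_Phi1 (hT : A.IsReynolds lam T) (hV : R.IsReynolds lam T TV) (h : L →ₗ[K] V)
    (Y : ⋀[K]^2 L) :
    (R.descendent hT hV).endI (Phi1 T TV h) Y
      = (LinearMap.id + lam • TV : V →ₗ[K] V) (R.endI h (exteriorPower.map 2 T Y))
        - TV (R.endI h (wedgeDeriv lam T Y)) := by
  induction Y using wedge_induction with
  | add Y Y' h h' => simp only [map_add, h, h']; abel
  | wedge x y =>
    have e : ∀ x u, (R.descendent hT hV).rho x u = _ := R.rhoT_apply lam T TV
    have e' : ∀ x u, (R.descendent hT hV).rho x (TV u) = _ := hV.rhoT_map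
    have b : T ((A.descendent hT).br x y) = A.br (T x) (T y) := hT.map_brT x y
    have b' : (A.descendent hT).br x y = _ := A.brT_apply lam T x y
    simp only [map_wedge, wedgeDeriv_wedge, map_add, map_smul, Rep.endI_wedge, Phi1_apply, map_sub,
      e', b]
    simp only [e, b', LinearMap.add_apply, LinearMap.smul_apply, LinearMap.id_apply, map_add,
      map_smul]
    module

theorem endI_sandwich (hT : A.IsReynolds lam T) (hV : R.IsReynolds lam T TV) (h : L →ₗ[K] V)
    (Y : ⋀[K]^2 L) :
    (R.descendent hT hV).endI (sandwich T TV h) Y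
      = TV (R.endI h (exteriorPower.map 2 T Y)) := by
  induction Y using wedge_induction with
  | add Y Y' h h' => simp only [map_add, h, h']
  | wedge x y =>
    have e' : ∀ x u, (R.descendent hT hV).rho x (TV u) = _ := hV.rhoT_map
    have b : T ((A.descendent hT).br x y) = A.br (T x) (T y) := hT.map_brT x y
    simp only [map_wedge, Rep.endI_wedge, sandwich_apply, map_sub, e', b]

theorem endII_Phi1 (hT : A.IsReynolds lam T) (hV : R.IsReynolds lam T TV) (h : L →ₗ[K] V)
    (Y : ⋀[K]^2 L) :
    (R.descendent hT hV).endII (Phi1 T TV h) Y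
      = Phi1 T TV (R.endII h (exteriorPower.map 2 T Y))
        - sandwich T TV (R.endII h (wedgeDeriv lam T Y)) := by
  induction Y using wedge_induction with
  | add Y Y' h h' => simp only [map_add, h, h']; abel
  | wedge x y =>
    have e : ∀ x y u, (R.descendent hT hV).theta x y u = _ := R.thetaT_apply lam T TV
    have e' : ∀ x y u, (R.descendent hT hV).theta x y (TV u) = _ := hV.thetaT_map
    ext z
    simp only [map_wedge, wedgeDeriv_wedge, map_add, map_smul, Rep.endII_wedge, Phi1_apply,
      map_sub, e', LinearMap.sub_apply, LinearMap.add_apply, LinearMap.smul_apply, sandwich_apply]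
    simp only [e, map_add, map_smul]
    module

theorem endII_sandwich (hT : A.IsReynolds lam T) (hV : R.IsReynolds lam T TV) (h : L →ₗ[K] V)
    (Y : ⋀[K]^2 L) :
    (R.descendent hT hV).endII (sandwich T TV h) Y
      = sandwich T TV (R.endII h (exteriorPower.map 2 T Y)) := by
  induction Y using wedge_induction with
  | add Y Y' h h' => simp only [map_add, h, h']
  | wedge x y =>
    have e' : ∀ x y u, (R.descendent hT hV).theta x y (TV u) = _ := hV.thetaT_map
    ext z
    simp only [map_wedge, Rep.endII_wedge, sandwich_apply, map_sub, e']

theorem DW_comp_Phi1 (hT : A.IsReynolds lam T) (hV : R.IsReynolds lam T TV) (Y : ⋀[K]^2 L)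
    (h : L →ₗ[K] V) :
    (R.descendent hT hV).DW Y ∘ₗ Phi1 T TV h
      = Phi1 T TV (R.DW (exteriorPower.map 2 T Y) ∘ₗ h)
        - sandwich T TV (R.DW (wedgeDeriv lam T Y) ∘ₗ h) := by
  ext z
  simp only [LinearMap.comp_apply, LinearMap.sub_apply, Phi1_apply, sandwich_apply, map_sub,
    hV.DW_TV hT]
  rw [hV.DW_apply hT]
  abel

theorem DW_comp_sandwich (hT : A.IsReynolds lam T) (hV : R.IsReynolds lam T TV) (Y : ⋀[K]^2 L)
    (h : L →ₗ[K] V) :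
    (R.descendent hT hV).DW Y ∘ₗ sandwich T TV h
      = sandwich T TV (R.DW (exteriorPower.map 2 T Y) ∘ₗ h) := by
  ext z
  simp only [LinearMap.comp_apply, sandwich_apply, hV.DW_TV hT]

theorem Phi1_comp_act (hT : A.IsReynolds lam T) (TV : V →ₗ[K] V) (Y : ⋀[K]^2 L)
    (h : L →ₗ[K] V) :
    Phi1 T TV h ∘ₗ (A.descendent hT).act Y
      = Phi1 T TV (h ∘ₗ A.act (exteriorPower.map 2 T Y))
        - sandwich T TV (h ∘ₗ A.act (wedgeDeriv lam T Y)) := by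
  ext z
  simp only [LinearMap.comp_apply, LinearMap.sub_apply, Phi1_apply, sandwich_apply, hT.map_act]
  rw [hT.act_apply, map_add, map_add]
  abel

theorem sandwich_comp_act (hT : A.IsReynolds lam T) (TV : V →ₗ[K] V) (Y : ⋀[K]^2 L)
    (h : L →ₗ[K] V) :
    sandwich T TV h ∘ₗ (A.descendent hT).act Y
      = sandwich T TV (h ∘ₗ A.act (exteriorPower.map 2 T Y)) := by
  ext z
  simp only [LinearMap.comp_apply, sandwich_apply, hT.map_act]

/-! ### The map `Φ` is a cochain map -/

theorem Phi_delta1 (hT : A.IsReynolds lam T) (hV : R.IsReynolds lam T TV) (f : L →ₗ[K] V) :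
    Phi 1 lam T TV (R.delta1 f) = (R.descendent hT hV).delta1 (Phi1 T TV f) := by
  refine Prod.ext ?_ ?_
  · change PhiI 1 lam T TV (MultilinearMap.ofSubsingleton K _ V (0 : Fin 1) (R.endI f))
      = MultilinearMap.ofSubsingleton K _ V (0 : Fin 1) _
    rw [PhiI_eq_twist, twist_ofSubsingleton]
    congr 1
    refine LinearMap.ext fun Y => ?_
    exact (endI_Phi1 hT hV f Y).symm
  · change PhiII 1 lam T TV (MultilinearMap.ofSubsingleton K _ (L →ₗ[K] V) (0 : Fin 1)
        (((LinearMap.llcomp K L V V).flip f ∘ₗ R.DW) + R.endII f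
          - (LinearMap.llcomp K L L V f ∘ₗ A.act)))
      = MultilinearMap.ofSubsingleton K _ (L →ₗ[K] V) (0 : Fin 1)
        (((LinearMap.llcomp K L V V).flip (Phi1 T TV f) ∘ₗ (R.descendent hT hV).DW)
          + (R.descendent hT hV).endII (Phi1 T TV f)
          - (LinearMap.llcomp K L L V (Phi1 T TV f) ∘ₗ (A.descendent hT).act))
    rw [PhiII_eq_twist, twist_ofSubsingleton]
    congr 1
    refine LinearMap.ext fun Y => ?_
    have h₁ := DW_comp_Phi1 hT hV Y f
    have h₂ := endII_Phi1 hT hV f Y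
    have h₃ := Phi1_comp_act hT TV Y f
    change Phi1 T TV (R.DW (exteriorPower.map 2 T Y) ∘ₗ f + R.endII f (exteriorPower.map 2 T Y)
        - f ∘ₗ A.act (exteriorPower.map 2 T Y))
      - sandwich T TV (R.DW (wedgeDeriv lam T Y) ∘ₗ f + R.endII f (wedgeDeriv lam T Y)
        - f ∘ₗ A.act (wedgeDeriv lam T Y))
      = (R.descendent hT hV).DW Y ∘ₗ Phi1 T TV f + (R.descendent hT hV).endII (Phi1 T TV f) Y
        - Phi1 T TV f ∘ₗ (A.descendent hT).act Y
    rw [h₁, h₂, h₃]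
    simp only [map_add, map_sub]
    abel

theorem PhiI_deltaI (hT : A.IsReynolds lam T) (hV : R.IsReynolds lam T TV) (n : ℕ)
    (c : Cochain K L V n) :
    PhiI (n + 1) lam T TV (R.deltaI n c)
      = (R.descendent hT hV).deltaI n (Phi n lam T TV c) := by
  change _ = (R.descendent hT hV).deltaI n (PhiI n lam T TV c.1, PhiII n lam T TV c.2)
  simp only [PhiI_eq_twist, PhiII_eq_twist, Rep.deltaI, map_add, map_sum, map_smul]
  have hD : ∀ Y u, (R.descendent hT hV).DW Y ((LinearMap.id + lam • TV : V →ₗ[K] V) u)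
      = (LinearMap.id + lam • TV : V →ₗ[K] V) (R.DW (exteriorPower.map 2 T Y) u)
        - TV (R.DW (wedgeDeriv lam T Y) u) := fun Y u => by
    simp only [LinearMap.add_apply, LinearMap.smul_apply, LinearMap.id_apply, map_add, map_smul,
      hV.DW_TV hT]
    rw [hV.DW_apply hT]
    abel
  simp only [twist_lastTerm (endI_Phi1 hT hV) (endI_sandwich hT hV),
    twist_omitTerm hD (hV.DW_TV hT), twist_moveTerm hT.map_actWedge hT.wedgeDeriv_actWedge]

theorem PhiII_deltaII (hT : A.IsReynolds lam T) (hV : R.IsReynolds lam T TV) (n : ℕ)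
    (c : Cochain K L V n) :
    PhiII (n + 1) lam T TV (R.deltaII n c)
      = (R.descendent hT hV).deltaII n (Phi n lam T TV c) := by
  change _ = (R.descendent hT hV).deltaII n (PhiI n lam T TV c.1, PhiII n lam T TV c.2)
  simp only [PhiII_eq_twist, Rep.deltaII, map_add, map_sum, map_smul]
  have hD := fun k => twist_omitTerm (n := n) (P := Phi1 T TV) (Q := sandwich T TV)
    (P₁ := Phi1 T TV) (Q₁ := sandwich T TV)
    (B := LinearMap.llcomp K L V V ∘ₗ R.DW)
    (B' := LinearMap.llcomp K L V V ∘ₗ (R.descendent hT hV).DW)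
    (DW_comp_Phi1 hT hV) (DW_comp_sandwich hT hV) k c.2
  have hA := fun k => twist_omitTerm (n := n) (P := Phi1 T TV) (Q := sandwich T TV)
    (P₁ := Phi1 T TV) (Q₁ := sandwich T TV)
    (B := (LinearMap.llcomp K L L V).flip ∘ₗ A.act)
    (B' := (LinearMap.llcomp K L L V).flip ∘ₗ (A.descendent hT).act)
    (Phi1_comp_act hT TV) (sandwich_comp_act hT TV) k c.2
  simp only [twist_lastTerm (endII_Phi1 hT hV) (endII_sandwich hT hV), hD, hA,
    twist_moveTerm hT.map_actWedge hT.wedgeDeriv_actWedge]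

end Structure

end LieYam

theorem mainTheorem3 {K L V : Type*} [Field K] [CharZero K] [AddCommGroup L] [Module K L]
    [AddCommGroup V] [Module K V] (A : LieYam.LieYamaguti K L) (R : LieYam.Rep A V) (lam : K)
    (T : L →ₗ[K] L) (hT : A.IsReynolds lam T) (TV : V →ₗ[K] V) (hTV : R.IsReynolds lam T TV) :
    LieYam.Phi 1 lam T TV ∘ₗ R.delta1 = (R.descendent hT hTV).delta1 ∘ₗ LieYam.Phi1 T TV ∧
    ∀ n : ℕ, 1 ≤ n →
      LieYam.Phi (n + 1) lam T TV ∘ₗ R.delta n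
        = (R.descendent hT hTV).delta n ∘ₗ LieYam.Phi n lam T TV :=
  ⟨LinearMap.ext fun f => LieYam.Phi_delta1 hT hTV f, fun n _ => LinearMap.ext fun c =>
    Prod.ext (LieYam.PhiI_deltaI hT hTV n c) (LieYam.PhiII_deltaII hT hTV n c)⟩
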